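/- For $n \ge 0$ let $[n] = \{0 < 1 < \dots < n\}$. Let $\mathrm{Kpt}^n$ be the sub-bisimplicial set of the representable bisimplicial set $\Delta^{n,n}$ spanned by the vertices $(i,j)$ with $0 \le i \le j \le n$; that is, the $(p,q)$-simplices of $\mathrm{Kpt}^n$ are the pairs of order-preserving maps $f : [p] \to [n]$, $g : [q] \to [n]$ such that $f(a) \le g(b)$ for all $a \in [p]$, $b \in [q]$. Let $\square^n = \delta_2^* \mathrm{Kpt}^n$ be its diagonal simplicial set, so that $(\square^n)_m = (\mathrm{Kpt}^n)_{m,m}$. Let $\mathrm{Cpt}^n \subset [n] \times [n]$ be the subset of the pairs $(i,j)$ with $i \le j$, with the order induced by the product order. **Proposition.** For every $n \ge 0$ the inclusion $\square^n \hookrightarrow N(\mathrm{Cpt}^n)$ into the nerve of $\mathrm{Cpt}^n$, which sends an $m$-simplex $(f,g)$ to the chain $(f(0),g(0)) \le \dots \le (f(m),g(m))$, is inner anodyne, i.e. it has the left lifting property with respect to all inner fibrations of simplicial sets (the maps with the right lifting property with respect to all inner horn inclusions $\Lambda^k_i \subset \Delta^k$, $0 < i < k$). -/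

import Mathlib

open CategoryTheory Opposite Simplicial

/-- The category of bisimplicial sets: presheaves of sets on `Δ × Δ`. -/
abbrev BiSSet : Type 1 := (SimplexCategory × SimplexCategory)ᵒᵖ ⥤ Type

namespace BiSSet

/-- The diagonal functor `δ₂^*` from bisimplicial sets to simplicial sets: restriction along
`Δ ⥤ Δ × Δ`, so that `(δ₂^* X)_m = X_{m,m}`. -/
abbrev diagonal : BiSSet ⥤ SSet.{0} :=
  (Functor.whiskeringLeft _ _ _).obj (Functor.diag SimplexCategory).op

/-- The representable bisimplicial set `Δ^{a,b}`. Its `(p,q)`-simplices are the pairs of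
morphisms `⦋p⦌ ⟶ ⦋a⦌`, `⦋q⦌ ⟶ ⦋b⦌` of the simplex category. -/
abbrev stdBisimplex (a b : ℕ) : BiSSet := yoneda.obj (⦋a⦌, ⦋b⦌)

/-- The sub-bisimplicial set of `X` spanned by a set `V` of vertices: it consists of all
the simplices of `X` all of whose vertices belong to `V`. -/
def spannedBy (X : BiSSet) (V : Set (X.obj (op (⦋0⦌, ⦋0⦌)))) : Subfunctor X where
  obj U := {x | ∀ v : ((⦋0⦌, ⦋0⦌) : SimplexCategory × SimplexCategory) ⟶ U.unop,
    X.map v.op x ∈ V}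
  map {U W} f x hx v := by
    have h := hx (v ≫ f.unop)
    rw [op_comp, Quiver.Hom.op_unop, Functor.map_comp_apply] at h
    exact h

end BiSSet

/-- The bisimplicial set `Kpt^n`: the sub-bisimplicial set of `Δ^{n,n}` spanned by the
vertices `(i, j)` with `0 ≤ i ≤ j ≤ n`. -/
def Kpt (n : ℕ) : Subfunctor (BiSSet.stdBisimplex n n) :=
  BiSSet.spannedBy _ {v | v.1 (0 : Fin 1) ≤ v.2 (0 : Fin 1)}

/-- The simplicial set `□^n = δ₂^* Kpt^n`. -/
abbrev boxSSet (n : ℕ) : SSet.{0} := BiSSet.diagonal.obj (Kpt n).toFunctor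

/-- The partially ordered set `Cpt^n` of the pairs `(i, j)` with `0 ≤ i ≤ j ≤ n`, with the
order induced by the product order on `[n] × [n]`. -/
abbrev Cpt (n : ℕ) : Type := {x : Fin (n + 1) × Fin (n + 1) // x.1 ≤ x.2}

lemma Kpt_apply_le {n : ℕ} {m : SimplexCategory}
    (x : (boxSSet n).obj (op m)) (i : Fin (m.len + 1)) :
    x.1.1 i ≤ x.1.2 i :=
  x.2 (SimplexCategory.const ⦋0⦌ m i, SimplexCategory.const ⦋0⦌ m i)

/-- The inclusion of `□^n` into the nerve of `Cpt^n`: an `m`-simplex of `□^n`, that is, a pair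
of morphisms `f, g : ⦋m⦌ ⟶ ⦋n⦌` lying in `Kpt^n`, is sent to the chain
`(f 0, g 0) ≤ ⋯ ≤ (f m, g m)`. -/
def boxInclusion (n : ℕ) : boxSSet n ⟶ nerve (Cpt n) where
  app m := ↾fun x ↦ Monotone.functor
    (f := fun i : Fin (m.unop.len + 1) ↦ (⟨(x.1.1 i, x.1.2 i), Kpt_apply_le x i⟩ : Cpt n))
    (fun _ _ h ↦ ⟨x.1.1.toOrderHom.monotone h, x.1.2.toOrderHom.monotone h⟩)
  naturality _ _ _ := rfl

/-! A strict chain misses □^n exactly when some first coordinate exceeds b, the second coordinate of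
its initial vertex. Let c be the second coordinate of the first vertex where this happens. Deleting
the pivot (b, c) just before that vertex, or inserting it if absent, pairs off the missing
nondegenerate simplices. The pivot is neither first nor last, so each pair fills an inner horn. The
fillings can be ordered consistently because pivots strictly change in lexicographic order along the
ancestry of pairs (`IsPivot.toLex_lt_toLex`). -/

namespace Cpt

variable {n d : ℕ}

/-- The index `l` is the first one at which the first coordinate of the sequence `z` exceeds
the second coordinate of `z 0`. -/
def IsFirst (z : Fin (d + 1) → Cpt n) (l : Fin (d + 1)) : Prop :=
  (z 0).1.2 < (z l).1.1 ∧ ∀ j < l, (z j).1.1 ≤ (z 0).1.2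

/-- The vertex `x l.castSucc` is `(b, c)` where `b` is the second coordinate of `x 0`
and `c` is the second coordinate of `x l.succ`, whose first coordinate exceeds `b`. -/
def IsPivot (x : Fin (d + 2) → Cpt n) (l : Fin (d + 1)) : Prop :=
  (x l.castSucc).1.1 = (x 0).1.2 ∧ (x l.castSucc).1.2 = (x l.succ).1.2 ∧
    (x 0).1.2 < (x l.succ).1.1

lemma IsFirst.unique {z : Fin (d + 1) → Cpt n} {l l' : Fin (d + 1)}
    (h : IsFirst z l) (h' : IsFirst z l') : l = l' := by
  rcases lt_trichotomy l l' with hl | hl | hl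
  · exact absurd h.1 (not_lt.2 (h'.2 l hl))
  · exact hl
  · exact absurd h'.1 (not_lt.2 (h.2 l' hl))

lemma IsFirst.ne_zero {z : Fin (d + 1) → Cpt n} {l : Fin (d + 1)} (h : IsFirst z l) : l ≠ 0 := by
  rintro rfl
  exact absurd h.1 (not_lt.2 (z 0).2)

lemma exists_isFirst {z : Fin (d + 1) → Cpt n} {i : Fin (d + 1)}
    (hi : (z 0).1.2 < (z i).1.1) : ∃ l, IsFirst z l := by
  classical
  induction i using WellFoundedLT.induction with
  | ind i ih =>
    by_cases h : ∃ j < i, (z 0).1.2 < (z j).1.1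
    · obtain ⟨j, hj, hj'⟩ := h
      exact ih j hj hj'
    · push Not at h
      exact ⟨i, hi, h⟩

/-! ### Uniqueness and deletion of pivots -/

namespace IsPivot

variable {x : Fin (d + 2) → Cpt n} {l : Fin (d + 1)}

lemma isFirst (h : IsPivot x l) (hx : Monotone x) : IsFirst x l.succ :=
  ⟨h.2.2, fun _ hj ↦ h.1 ▸ (hx (Fin.le_castSucc_iff.2 hj)).1⟩

lemma unique {l' : Fin (d + 1)} (h : IsPivot x l) (h' : IsPivot x l') (hx : Monotone x) :
    l = l' :=
  Fin.succ_injective _ ((h.isFirst hx).unique (h'.isFirst hx))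

lemma ne_zero (h : IsPivot x l) : l ≠ 0 := by
  rintro rfl
  obtain ⟨-, h₂, h₃⟩ := h
  exact absurd (h₃.trans_le ((x _).2.trans h₂.ge)) (lt_irrefl _)

lemma castSucc_ne_zero (h : IsPivot x l) : l.castSucc ≠ 0 :=
  fun h' ↦ h.ne_zero (Fin.castSucc_injective _ h')

lemma removeNth_zero (h : IsPivot x l) : x (l.castSucc.succAbove 0) = x 0 := by
  rw [Fin.succAbove_ne_zero_zero h.castSucc_ne_zero]

lemma isFirst_removeNth (h : IsPivot x l) (hx : Monotone x) :
    IsFirst (fun j ↦ x (l.castSucc.succAbove j)) l := by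
  dsimp only [IsFirst]
  rw [h.removeNth_zero, Fin.succAbove_castSucc_self]
  refine ⟨h.2.2, fun j hj ↦ (h.isFirst hx).2 _ ?_⟩
  rw [Fin.succAbove_of_castSucc_lt _ _ (by simpa using hj)]
  simpa using hj.le

lemma apply_castSucc (h : IsPivot x l) :
    (x l.castSucc).1 = ((x (l.castSucc.succAbove 0)).1.2, (x (l.castSucc.succAbove l)).1.2) := by
  rw [h.removeNth_zero, Fin.succAbove_castSucc_self]
  exact Prod.ext h.1 h.2.1

/-- Both the position and the coordinates of a deleted pivot can be read off from the remaining
face. -/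
lemma ext {y : Fin (d + 2) → Cpt n} {l' : Fin (d + 1)} (hx : Monotone x) (hy : Monotone y)
    (h : IsPivot x l) (h' : IsPivot y l')
    (hxy : ∀ j, x (l.castSucc.succAbove j) = y (l'.castSucc.succAbove j)) :
    l = l' ∧ x = y := by
  obtain rfl : l = l' := by
    refine (h.isFirst_removeNth hx).unique ?_
    rw [funext hxy]
    exact h'.isFirst_removeNth hy
  refine ⟨rfl, funext fun j ↦ ?_⟩
  obtain rfl | ⟨j, rfl⟩ := Fin.eq_self_or_eq_succAbove l.castSucc j
  · ext1
    rw [h.apply_castSucc, h'.apply_castSucc, hxy, hxy]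
  · exact hxy j

lemma removeNth_lt (h : IsPivot x l) (hx : StrictMono x) {j : Fin (d + 1)} (hj : j < l) :
    (x (l.castSucc.succAbove j)).1 <
      ((x (l.castSucc.succAbove 0)).1.2, (x (l.castSucc.succAbove l)).1.2) := by
  rw [← h.apply_castSucc, Fin.succAbove_of_castSucc_lt _ _ (by simpa using hj)]
  exact hx (by simpa using hj)

/-- A pivot of the face would repeat the deleted vertex, against strictness. -/
lemma not_isPivot_removeNth {x : Fin (d + 3) → Cpt n} {l : Fin (d + 2)} (hx : StrictMono x)
    (h : IsPivot x l) (l' : Fin (d + 1)) :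
    ¬ IsPivot (fun j ↦ x (l.castSucc.succAbove j)) l' := by
  intro h'
  obtain rfl : l = l'.succ := (h.isFirst_removeNth hx.monotone).unique
    (h'.isFirst (hx.monotone.comp (Fin.strictMono_succAbove _).monotone))
  exact (h.removeNth_lt hx (j := l'.castSucc) (by simp [Fin.lt_def])).ne (Prod.ext h'.1 h'.2.1)

/-- If removing from `y` a vertex other than the pivot yields the same sequence as removing the
pivot from `x`, then the coordinates of the pivot increase lexicographically from `y` to `x`. -/
lemma toLex_lt_toLex {y : Fin (d + 2) → Cpt n} {l' : Fin (d + 1)} (hx : StrictMono x)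
    (hy : StrictMono y) (h : IsPivot x l) (h' : IsPivot y l') {i : Fin (d + 2)}
    (hi : i ≠ l'.castSucc) (hxy : ∀ j, x (l.castSucc.succAbove j) = y (i.succAbove j)) :
    toLex (y l'.castSucc).1 < toLex (x l.castSucc).1 := by
  have hf := h.isFirst_removeNth hx.monotone
  have hlt : ∀ j < l, _ := fun j hj ↦ h.removeNth_lt hx hj
  have hp := h.apply_castSucc
  simp only [hxy] at hf hlt hp
  rw [hp, Prod.Lex.toLex_lt_toLex, h'.1]
  -- Deleting a vertex can only raise b. If b stays, c can only rise; if c stays too, the pivot of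
  -- `y` survives in the face before index `l`, where `hlt` forbids it.
  have h₀ : (y 0).1.2 ≤ (y (i.succAbove 0)).1.2 := (hy.monotone (Fin.zero_le _)).2
  refine h₀.lt_or_eq.imp_right fun h₀ ↦ ⟨h₀, ?_⟩
  have hl : l'.succ ≤ i.succAbove l := by
    by_contra! hl
    exact absurd ((h'.isFirst hy.monotone).2 _ hl) (not_le.2 (h₀ ▸ hf.1))
  rw [h'.2.1]
  refine lt_of_le_of_ne (hy.monotone hl).2 fun h₁ ↦ ?_
  obtain ⟨j, hj⟩ := Fin.exists_succAbove_eq hi.symm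
  have hj' : j < l := by
    rw [← (Fin.strictMono_succAbove i).lt_iff_lt, hj]
    exact Fin.castSucc_lt_iff_succ_le.2 hl
  refine (hlt j hj').ne ?_
  rw [hj]
  exact Prod.ext (h'.1.trans h₀) (h'.2.1.trans h₁)

end IsPivot

/-- Given a sequence `z` and an index `l`, insert just before `z l` the vertex whose coordinates
are the second coordinates of `z 0` and `z l`. -/
def insertPivot (z : Fin (d + 1) → Cpt n) (hz : Monotone z) (l : Fin (d + 1)) :
    Fin (d + 2) → Cpt n :=
  Fin.insertNth (α := fun _ ↦ Cpt n) l.castSucc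
    ⟨((z 0).1.2, (z l).1.2), (hz (Fin.zero_le l)).2⟩ z

/-! ### Insertion of pivots -/

section

variable {z : Fin (d + 1) → Cpt n} (hz : Monotone z) {l : Fin (d + 1)}

@[simp]
lemma insertPivot_castSucc :
    insertPivot z hz l l.castSucc = ⟨((z 0).1.2, (z l).1.2), (hz (Fin.zero_le l)).2⟩ := by
  simp [insertPivot]

@[simp]
lemma insertPivot_succAbove (j : Fin (d + 1)) :
    insertPivot z hz l (l.castSucc.succAbove j) = z j := by
  simp [insertPivot]

@[simp]
lemma insertPivot_succ : insertPivot z hz l l.succ = z l := by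
  rw [← Fin.succAbove_castSucc_self, insertPivot_succAbove]

lemma IsFirst.insertPivot_zero (h : IsFirst z l) : insertPivot z hz l 0 = z 0 := by
  rw [← insertPivot_succAbove hz (l := l) 0, Fin.succAbove_ne_zero_zero]
  exact fun h' ↦ h.ne_zero (Fin.castSucc_injective _ h')

lemma IsFirst.isPivot_insertPivot (h : IsFirst z l) : IsPivot (insertPivot z hz l) l := by
  simp [IsPivot, h.insertPivot_zero, h.1]

lemma IsFirst.strictMono_insertPivot (h : IsFirst z l) (hz' : StrictMono z)
    (hl : ∀ j < l, (z j).1 ≠ ((z 0).1.2, (z l).1.2)) :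
    StrictMono (insertPivot z hz l) := by
  intro a b hab
  obtain rfl | ⟨a, rfl⟩ := Fin.eq_self_or_eq_succAbove l.castSucc a
  · obtain rfl | ⟨b, rfl⟩ := Fin.eq_self_or_eq_succAbove l.castSucc b
    · exact absurd hab (lt_irrefl _)
    · have hb : l ≤ b := by simpa [Fin.lt_succAbove_iff_le_castSucc] using hab
      rw [insertPivot_castSucc, insertPivot_succAbove]
      refine lt_of_lt_of_le ?_ (hz hb)
      exact Prod.mk_lt_mk.2 (Or.inl ⟨h.1, le_rfl⟩)
  · obtain rfl | ⟨b, rfl⟩ := Fin.eq_self_or_eq_succAbove l.castSucc b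
    · have ha : a < l := by simpa [Fin.succAbove_lt_iff_castSucc_lt] using hab
      rw [insertPivot_castSucc, insertPivot_succAbove]
      exact lt_of_le_of_ne ⟨h.2 a ha, (hz ha.le).2⟩ fun h' ↦ hl a ha (congr_arg Subtype.val h')
    · simpa using hz' ((Fin.strictMono_succAbove _).lt_iff_lt.1 hab)

end

/-- The vertex just before `l` is squeezed between `z j` and (b, c), hence equals (b, c). -/
lemma IsFirst.exists_isPivot {z : Fin (d + 2) → Cpt n} {l : Fin (d + 2)} (h : IsFirst z l)
    (hz : StrictMono z) {j : Fin (d + 2)} (hj : j < l)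
    (hjl : (z j).1 = ((z 0).1.2, (z l).1.2)) : ∃ k, IsPivot z k := by
  obtain ⟨l, rfl⟩ := Fin.exists_succ_eq.2 h.ne_zero
  have hl : l.castSucc < l.succ := Fin.castSucc_lt_succ
  have h₁ : z j ≤ z l.castSucc := hz.monotone (Fin.le_castSucc_iff.2 hj)
  have h₂ : (z l.castSucc).1 ≤ (z j).1 := hjl ▸ ⟨h.2 _ hl, (hz.monotone hl.le).2⟩
  have h₃ := (le_antisymm h₂ h₁).trans hjl
  exact ⟨l, (Prod.ext_iff.1 h₃).1, (Prod.ext_iff.1 h₃).2, h.1⟩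

end Cpt

/-- Second coordinates increase, so comparing with the initial one suffices. -/
lemma mem_range_boxInclusion_iff {n d : ℕ} (x : (nerve (Cpt n)) _⦋d⦌) :
    x ∈ (SSet.Subcomplex.range (boxInclusion n)).obj _ ↔
      ∀ i, (x.obj i).1.1 ≤ (x.obj 0).1.2 := by
  constructor
  · rintro ⟨y, rfl⟩ i
    exact y.2 (SimplexCategory.const ⦋0⦌ ⦋d⦌ i, SimplexCategory.const ⦋0⦌ ⦋d⦌ 0)
  · intro h
    refine ⟨⟨(SimplexCategory.Hom.mk ⟨fun i ↦ (x.obj i).1.1, fun i j hij ↦ (x.monotone hij).1⟩,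
      SimplexCategory.Hom.mk ⟨fun i ↦ (x.obj i).1.2, fun i j hij ↦ (x.monotone hij).2⟩),
      fun v ↦ ?_⟩, ?_⟩
    · exact (h _).trans (x.monotone (Fin.zero_le _)).2
    · ext i <;> rfl

lemma notMem_range_boxInclusion_iff {n d : ℕ} (x : (nerve (Cpt n)) _⦋d⦌) :
    x ∉ (SSet.Subcomplex.range (boxInclusion n)).obj _ ↔ ∃ l, Cpt.IsFirst x.obj l := by
  rw [mem_range_boxInclusion_iff]
  push Not
  exact ⟨fun ⟨_, hi⟩ ↦ Cpt.exists_isFirst hi, fun ⟨l, hl⟩ ↦ ⟨l, hl.1⟩⟩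

instance (n : ℕ) : Mono (boxInclusion n) := by
  rw [NatTrans.mono_iff_mono_app]
  intro m
  rw [mono_iff_injective]
  intro x y h
  have h' (i) : (x.1.1 i, x.1.2 i) = (y.1.1 i, y.1.2 i) :=
    congr_arg Subtype.val (Functor.congr_obj h i)
  refine Subtype.ext (Prod.ext ?_ ?_) <;> ext i : 3
  · exact congr_arg Prod.fst (h' i)
  · exact congr_arg Prod.snd (h' i)

/-! ### The regular inner pairing -/

namespace Cpt

/-- The type (I) simplices: the strictly increasing sequences in `Cpt n` equipped with a pivot. -/
structure PivotSimplex (n : ℕ) where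
  /-- the dimension of the face opposite to the pivot -/
  dim : ℕ
  /-- the simplex -/
  simplex : (nerve (Cpt n)) _⦋dim + 1⦌
  strictMono : StrictMono simplex.obj
  /-- the position of the pivot -/
  index : Fin (dim + 1)
  isPivot : IsPivot simplex.obj index

lemma PivotSimplex.isFirst_δ {n : ℕ} (s : PivotSimplex n) :
    IsFirst ((nerve (Cpt n)).δ s.index.castSucc s.simplex).obj s.index :=
  s.isPivot.isFirst_removeNth s.strictMono.monotone

/-- The pairing on the simplices of the nerve of `Cpt n` that are not in `boxSSet n`: it pairs
each simplex having a pivot with its face opposite to the pivot. -/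
noncomputable def pairingCore (n : ℕ) :
    (SSet.Subcomplex.range (boxInclusion n)).PairingCore where
  ι := PivotSimplex n
  dim s := s.dim
  simplex s := s.simplex
  index s := s.index.castSucc
  nonDegenerate₁ s := (PartialOrder.mem_nerve_nonDegenerate_iff_strictMono _).2 s.strictMono
  nonDegenerate₂ s := (PartialOrder.mem_nerve_nonDegenerate_iff_strictMono _).2
    (s.strictMono.comp (Fin.strictMono_succAbove _))
  notMem₁ s := (notMem_range_boxInclusion_iff _).2
    ⟨_, s.isPivot.isFirst s.strictMono.monotone⟩
  notMem₂ s := (notMem_range_boxInclusion_iff _).2 ⟨_, s.isFirst_δ⟩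
  injective_type₁' {s t} h := by
    obtain ⟨d, x, hx, l, h₁⟩ := s
    obtain ⟨d', y, hy, l', h₂⟩ := t
    obtain rfl : d = d' := by simpa using SSet.S.dim_eq_of_mk_eq h
    obtain rfl := (SSet.S.ext_iff _ _).1 h
    obtain rfl := h₁.unique h₂ hx.monotone
    rfl
  injective_type₂' {s t} h := by
    obtain ⟨d, x, hx, l, h₁⟩ := s
    obtain ⟨d', y, hy, l', h₂⟩ := t
    obtain rfl : d = d' := SSet.S.dim_eq_of_mk_eq h
    obtain ⟨rfl, h₃⟩ := h₁.ext hx.monotone hy.monotone h₂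
      (Functor.congr_obj ((SSet.S.ext_iff _ _).1 h))
    obtain rfl : x = y := nerve.ext_of_isThin h₃
    rfl
  type₁_ne_type₂' s t h := by
    obtain ⟨d, x, hx, l, h₁⟩ := s
    obtain ⟨d', y, hy, l', h₂⟩ := t
    obtain rfl : d + 1 = d' := SSet.S.dim_eq_of_mk_eq h
    obtain rfl := (SSet.S.ext_iff _ _).1 h
    exact h₂.not_isPivot_removeNth hy _ h₁
  surjective' x := by
    obtain ⟨d, x, hx, hx', rfl⟩ := x.mk_surjective
    rw [PartialOrder.mem_nerve_nonDegenerate_iff_strictMono] at hx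
    obtain ⟨l, hl⟩ := (notMem_range_boxInclusion_iff _).1 hx'
    by_cases! h : ∃ j < l, (x.obj j).1 = ((x.obj 0).1.2, (x.obj l).1.2)
    · obtain ⟨j, hj, hjl⟩ := h
      obtain _ | d := d
      · exact absurd hj (by simp [Subsingleton.elim (α := Fin 1) j l])
      · obtain ⟨k, hk⟩ := hl.exists_isPivot hx hj hjl
        exact ⟨⟨d, x, hx, k, hk⟩, Or.inl rfl⟩
    · have hz := hl.strictMono_insertPivot hx.monotone hx h
      refine ⟨⟨d, hz.monotone.functor, hz, l, hl.isPivot_insertPivot hx.monotone⟩, Or.inr ?_⟩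
      refine congr_arg SSet.S.mk (nerve.ext_of_isThin (funext fun j ↦ ?_))
      exact (insertPivot_succAbove hx.monotone j).symm

instance (n : ℕ) : (pairingCore n).IsInner where
  ne_zero s := s.isPivot.castSucc_ne_zero
  ne_last s := Fin.castSucc_ne_last s.index

/-- The pairs of elements of `Fin (n + 1)` with the reverse lexicographic order, in which the
pivots decrease along the ancestrality relation, form a weak rank function. -/
noncomputable def weakRankFunction (n : ℕ) :
    (pairingCore n).WeakRankFunction (Fin (n + 1) ×ₗ Fin (n + 1))ᵒᵈ where
  rank s := OrderDual.toDual (toLex (s.simplex.obj s.index.castSucc).1)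
  lt := by
    rintro ⟨d, x, hx, l, h₁⟩ ⟨d', y, hy, l', h₂⟩ ⟨hne, hlt⟩ h
    obtain rfl : d = d' := h
    obtain ⟨f, hf, hfx⟩ := SSet.N.le_iff_exists_mono.1 hlt.le
    obtain ⟨i, rfl⟩ := @SimplexCategory.eq_δ_of_mono d f hf
    have hxy : ∀ j, x.obj (l.castSucc.succAbove j) = y.obj (i.succAbove j) :=
      fun j ↦ (Functor.congr_obj hfx j).symm
    refine h₁.toLex_lt_toLex hx hy h₂ ?_ hxy
    -- Deleting the pivot on both sides would identify the two pairs.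
    rintro rfl
    refine hne ((pairingCore n).injective_type₂' (congr_arg SSet.S.mk ?_))
    exact nerve.ext_of_isThin (funext hxy)

instance (n : ℕ) : (pairingCore n).IsRegular := (weakRankFunction n).isRegular

end Cpt

theorem mainTheorem6 (n : ℕ) : SSet.innerAnodyneExtensions (boxInclusion n) :=
  SSet.strongInnerAnodyneExtensions_le_innerAnodyneExtensions _
    ⟨inferInstance, (Cpt.pairingCore n).pairing, inferInstance, inferInstance⟩
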